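/- Let $k\ge 1$, $n\ge 0$, $m\ge 0$ be integers. Let $\mathrm{Li}_{-n,k}(z)=\sum_{0<m_1<m_2} m_1^{n} z^{m_2}/m_2^{k}$ for $|z|<1$, continued analytically to $\mathbb{C}\setminus[1,\infty)$, and for $\Re(s)>0$ put $$\eta(-n,k;s)=\frac{1}{\Gamma(s)}\int_0^\infty t^{s-1}\,\frac{\mathrm{Li}_{-n,k}(1-e^t)}{1-e^t}\,dt .$$ Define $D^{(n)}_l$ for $0\le l\le n+1$ by $$D^{(0)}_0=-1,\qquad D^{(n)}_0=0\ (n>0),\qquad D^{(n)}_l=\binom{n}{l}(-1)^{n-l}\zeta(-n+l)\ (1\le l\le n),\qquad D^{(n)}_{n+1}=\frac1{n+1},$$ where $\zeta$ is the Riemann zeta function. Let $$\zeta^\star(p_1,\dots,p_r)=\sum_{0<m_1\le\cdots\le m_r}\frac1{m_1^{p_1}\cdots m_r^{p_r}}\qquad(p_i\ge 1,\ p_r\ge 2),$$ and for $j\ge1$ put $$S_j(m)=\sum_{\substack{a_1+\cdots+a_j=m\\ \forall a_i\ge0}}(a_j+1)\,\zeta^\star(a_1+1,\dots,a_{j-1}+1,a_j+2),$$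 with the convention $S_0(m)=1$. Let $B_p^{(q)}$ ($q\in\mathbb Z$, $p\ge0$) be the poly-Bernoulli numbers, given by $\frac{\mathrm{Li}_q(1-e^{-t})}{1-e^{-t}}=\sum_{p\ge0}B_p^{(q)}\frac{t^p}{p!}$ with $\mathrm{Li}_q(z)=\sum_{j\ge1}z^j/j^q$. Then the continuation of $\mathrm{Li}_{-n,k}$ exists, the integral defining $\eta(-n,k;m+1)$ converges absolutely, and: if $k>n$, $$\eta(-n,k;m+1)=\sum_{l=0}^{n+1}D^{(n)}_l\,S_{k-l}(m);$$ if $k\le n$, $$\eta(-n,k;m+1)=\sum_{l=0}^{k-1}D^{(n)}_l\,S_{k-l}(m)+\sum_{l=k}^{n+1}D^{(n)}_l\,B^{(m+1)}_{l-k}.$$ -/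

import Mathlib

/-- Indices `0 < m₁ < m₂` of the double polylogarithm series. -/
abbrev DoublePolylogIndex : Type := {p : ℕ × ℕ // 0 < p.1 ∧ p.1 < p.2}

/-- The slit plane `ℂ ∖ [1, ∞)`. -/
def cutPlane : Set ℂ := {z | ¬ (1 ≤ z.re ∧ z.im = 0)}

/-- `F` is the analytic continuation to `ℂ ∖ [1, ∞)` of
`Li_{k₁,k₂}(z) = ∑_{0 < m₁ < m₂} z ^ m₂ / (m₁ ^ k₁ * m₂ ^ k₂)`, `|z| < 1`. -/
def IsDoublePolylog (k₁ k₂ : ℤ) (F : ℂ → ℂ) : Prop :=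
  DifferentiableOn ℂ F cutPlane ∧
    ∀ z : ℂ, ‖z‖ < 1 →
      HasSum (fun p : DoublePolylogIndex =>
        z ^ p.1.2 / ((p.1.1 : ℂ) ^ k₁ * (p.1.2 : ℂ) ^ k₂)) (F z)

/-- The double polylogarithm `Li_{k₁,k₂}` on `ℂ ∖ [1, ∞)`: the function singled out by
`IsDoublePolylog` (which is unique on `ℂ ∖ [1, ∞)` by the identity theorem). -/
noncomputable def doublePolylog (k₁ k₂ : ℤ) : ℂ → ℂ :=
  Classical.epsilon (IsDoublePolylog k₁ k₂)

/-- The integrand `t ^ (s-1) * Li_{k₁,k₂}(1 - e^t) / (1 - e^t)`. -/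
noncomputable def etaIntegrand (k₁ k₂ : ℤ) (s : ℂ) (t : ℝ) : ℂ :=
  (t : ℂ) ^ (s - 1) *
    (doublePolylog k₁ k₂ (1 - Complex.exp (t : ℂ)) / (1 - Complex.exp (t : ℂ)))

/-- `η(k₁,k₂;s)` for `Re s > 0`. -/
noncomputable def etaFun (k₁ k₂ : ℤ) (s : ℂ) : ℂ :=
  (1 / Complex.Gamma s) * ∫ t in Set.Ioi (0 : ℝ), etaIntegrand k₁ k₂ s t

/-- The multiple zeta star value
`ζ⋆(p₁,…,p_r) = ∑_{0 < m₁ ≤ ⋯ ≤ m_r} 1 / (m₁ ^ p₁ ⋯ m_r ^ p_r)`. -/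
noncomputable def zetaStar {r : ℕ} (p : Fin r → ℕ) : ℝ :=
  ∑' m : {m : Fin r → ℕ // (∀ i, 0 < m i) ∧ Monotone m}, 1 / ∏ i, ((m.1 i : ℝ) ^ p i)

/-- The sum
`∑_{a₁+⋯+a_j = m, a_i ≥ 0} (a_j + 1) ζ⋆(a₁+1, …, a_{j-1}+1, a_j+2)` for `j ≥ 1`;
for `j = 0` it is `1` by convention. -/
noncomputable def zetaStarSum (m : ℕ) : ℕ → ℝ
  | 0 => 1
  | r + 1 => ∑ a ∈ Finset.Nat.antidiagonalTuple (r + 1) m,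
      ((a (Fin.last r) : ℝ) + 1) *
        zetaStar (fun i => if i = Fin.last r then a i + 2 else a i + 1)

/-- The coefficients `D_l^{(n)}`, `0 ≤ l ≤ n + 1`. -/
noncomputable def faulhaberD (n l : ℕ) : ℂ :=
  if l = 0 then (if n = 0 then -1 else 0)
  else if l = n + 1 then 1 / ((n : ℂ) + 1)
  else (n.choose l : ℂ) * (-1) ^ (n - l) * riemannZeta (-(n : ℂ) + (l : ℂ))

/-- The formal power series `1 - e^{-t}`. -/
noncomputable def oneSubExpNeg : PowerSeries ℚ :=
  1 - PowerSeries.rescale (-1 : ℚ) (PowerSeries.exp ℚ)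

/-- The formal power series `Li_k(z) = ∑_{j ≥ 1} z ^ j / j ^ k`. -/
noncomputable def polylogSeries (k : ℤ) : PowerSeries ℚ :=
  PowerSeries.mk fun j => if j = 0 then 0 else 1 / (j : ℚ) ^ k

/-- The formal power series `Li_k(z) / z = ∑_{j ≥ 0} z ^ j / (j + 1) ^ k`. -/
noncomputable def polylogSeriesDivX (k : ℤ) : PowerSeries ℚ :=
  PowerSeries.mk fun j => 1 / ((j : ℚ) + 1) ^ k

/-- The generating series `Li_k(1 - e^{-t}) / (1 - e^{-t})`. -/
noncomputable def polyBernoulliSeries (k : ℤ) : PowerSeries ℚ :=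
  (polylogSeriesDivX k).subst oneSubExpNeg

/-- The poly-Bernoulli number `B_n^{(k)}`, given by
`Li_k(1 - e^{-t}) / (1 - e^{-t}) = ∑_n B_n^{(k)} t ^ n / n!`. -/
noncomputable def polyBernoulli (k : ℤ) (n : ℕ) : ℚ :=
  (n.factorial : ℚ) * PowerSeries.coeff n (polyBernoulliSeries k)

theorem hasSubst_oneSubExpNeg : PowerSeries.HasSubst oneSubExpNeg := by
  apply PowerSeries.HasSubst.of_constantCoeff_zero'
  rw [oneSubExpNeg, map_sub, ← PowerSeries.coeff_zero_eq_constantCoeff_apply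
    (PowerSeries.rescale (-1 : ℚ) (PowerSeries.exp ℚ)), PowerSeries.coeff_rescale]
  simp

/-- `polyBernoulliSeries k` is indeed the quotient of `Li_k(1 - e^{-t})` by `1 - e^{-t}`. -/
theorem oneSubExpNeg_mul_polyBernoulliSeries (k : ℤ) :
    oneSubExpNeg * polyBernoulliSeries k = (polylogSeries k).subst oneSubExpNeg := by
  have h : polylogSeries k = PowerSeries.X * polylogSeriesDivX k := by
    ext j
    cases j with
    | zero => simp [polylogSeries]
    | succ j => simp [polylogSeries, polylogSeriesDivX, PowerSeries.coeff_succ_X_mul]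
  rw [h, PowerSeries.subst_mul hasSubst_oneSubExpNeg, PowerSeries.subst_X hasSubst_oneSubExpNeg]
  rfl

open MeasureTheory Set Filter Topology

/-! Faulhaber's formula writes the inner sum over `m₁ < m₂` of `m₁ ^ n` as the polynomial `∑ D_l m₂
^ l`, because `ζ(-e)` is a Bernoulli number up to an elementary factor. Hence `Li_{-n,k} = ∑ D_l
Li_{k-l}`, and only the moments of `φ_q(t) = Li_q(1 - e^t) / (1 - e^t)` against `t^m / m!` on `(0,
∞)` are needed.

For `q ≥ 0`, `(e^t - 1) φ_{q+1}(t)` is the integral of `e^x φ_q(x)` over `[0, t]`. Expanding `1 /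
(e^t - 1)` geometrically and applying Tonelli's theorem gives a recursion in `q` for the moments
weighted by `e^{-Nt}` (`polylogMoment_succ`). It is the recursion that peels the smallest index off
a zeta star sum (`zetaStarTail_cons`), so the moment is `S_q(m)` (`polylogMoment_succ_eq_sum`). The
bound `polylogReal_le` gives convergence.

For `q = -p ≤ 0`, `Li_{-p}(z) / z` is a combination of powers `(1 - z)^{-(j+1)}`, which become
`e^{-(j+1)t}`. The coefficients are those of `(1 - e^{-t})^j`, so the moment is `B_p^{(m+1)}`
(`hasIntegral_pow_mul_polylogDivNeg`). -/

/-! ### The slit plane, star-shaped about the origin -/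

theorem isOpen_cutPlane : IsOpen cutPlane := by
  have h : cutPlane = {z : ℂ | z.re < 1} ∪ {z : ℂ | z.im ≠ 0} := by
    ext z
    simp only [cutPlane, mem_ofPred_eq, mem_union]
    rw [not_and_or, not_le]
  rw [h]
  exact (isOpen_lt Complex.continuous_re continuous_const).union
    (isOpen_ne_fun Complex.continuous_im continuous_const)

theorem mul_ofReal_mem_cutPlane {z : ℂ} (hz : z ∈ cutPlane) {u : ℝ} (hu : u ∈ Icc (0 : ℝ) 1) :
    z * u ∈ cutPlane := by
  simp only [cutPlane, mem_ofPred_eq, not_and_or, not_le, Complex.re_mul_ofReal,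
    Complex.im_mul_ofReal] at hz ⊢
  rcases hu with ⟨h0, h1⟩
  rcases h0.eq_or_lt with rfl | h0
  · simp
  · rcases hz with hz | hz
    · left
      nlinarith
    · right
      simp [hz, h0.ne']

theorem zero_mem_cutPlane : (0 : ℂ) ∈ cutPlane := by simp [cutPlane]

theorem starConvex_cutPlane : StarConvex ℝ 0 cutPlane := by
  rw [starConvex_zero_iff]
  intro z hz u h0 h1
  have := mul_ofReal_mem_cutPlane hz ⟨h0, h1⟩
  rwa [mul_comm] at this

theorem isPreconnected_cutPlane : IsPreconnected cutPlane :=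
  (starConvex_cutPlane.isPathConnected zero_mem_cutPlane).isConnected.isPreconnected

theorem one_sub_ne_zero_of_mem_cutPlane {z : ℂ} (hz : z ∈ cutPlane) : 1 - z ≠ 0 := by
  intro h
  have : z = 1 := by linear_combination -h
  subst this
  simp [cutPlane] at hz

theorem one_sub_exp_mem_cutPlane (t : ℝ) : 1 - Complex.exp (t : ℂ) ∈ cutPlane := by
  intro h
  have h1 := h.1
  rw [← Complex.ofReal_exp, Complex.sub_re, Complex.one_re, Complex.ofReal_re] at h1
  linarith [Real.exp_pos t]

/-! ### Polylogarithms of nonnegative order -/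

/-- Averaging along the segment from `0` to `z`; this sends `Li_q(z) / z` to
`Li_{q+1}(z) / z`. -/
noncomputable def segmentAverage (G : ℂ → ℂ) (z : ℂ) : ℂ := ∫ u in (0 : ℝ)..1, G (z * u)

theorem continuous_comp_mul_ofReal {G : ℂ → ℂ} (hG : ContinuousOn G cutPlane) {z : ℂ}
    (hz : z ∈ cutPlane) : ContinuousOn (fun u : ℝ => G (z * u)) (Icc 0 1) :=
  hG.comp (by fun_prop) fun _ hu => mul_ofReal_mem_cutPlane hz hu

theorem hasDerivAt_segmentAverage {G : ℂ → ℂ} (hG : DifferentiableOn ℂ G cutPlane) {z : ℂ}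
    (hz : z ∈ cutPlane) :
    HasDerivAt (segmentAverage G) (∫ u in (0 : ℝ)..1, deriv G (z * u) * u) z := by
  have hG' : ContinuousOn (deriv G) cutPlane := (hG.deriv isOpen_cutPlane).continuousOn
  obtain ⟨ε, hε, hball⟩ := Metric.nhds_basis_closedBall.mem_iff.1 (isOpen_cutPlane.mem_nhds hz)
  -- All segments from `0` to points near `z` lie in one compact subset of the slit plane, so a
  -- single constant dominates `deriv G` along them.
  have hK : IsCompact ((fun p : ℂ × ℝ => p.1 * p.2) '' (Metric.closedBall z ε ×ˢ Icc 0 1)) :=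
    ((isCompact_closedBall z ε).prod isCompact_Icc).image (by fun_prop)
  have hKU : (fun p : ℂ × ℝ => p.1 * p.2) '' (Metric.closedBall z ε ×ˢ Icc 0 1) ⊆ cutPlane := by
    rintro _ ⟨⟨w, u⟩, ⟨hw, hu⟩, rfl⟩
    exact mul_ofReal_mem_cutPlane (hball hw) hu
  obtain ⟨C, hC⟩ := hK.exists_bound_of_continuousOn (hG'.mono hKU)
  have huI : ∀ u ∈ uIoc (0 : ℝ) 1, u ∈ Icc (0 : ℝ) 1 := fun u hu =>
    Ioc_subset_Icc_self (by rwa [uIoc_of_le zero_le_one] at hu)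
  have hc : ∀ {H : ℂ → ℂ}, ContinuousOn H cutPlane → ∀ {w : ℂ}, w ∈ cutPlane →
      IntervalIntegrable (fun u : ℝ => H (w * u)) volume 0 1 := fun hH w hw => by
    apply ContinuousOn.intervalIntegrable
    rw [uIcc_of_le zero_le_one]
    exact continuous_comp_mul_ofReal hH hw
  refine (intervalIntegral.hasDerivAt_integral_of_dominated_loc_of_deriv_le
    (F' := fun w u => deriv G (w * u) * u) (bound := fun _ => C)
    (Metric.closedBall_mem_nhds z hε) ?_ (hc hG.continuousOn hz) ?_ ?_ (by simp) ?_).2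
  · filter_upwards [isOpen_cutPlane.mem_nhds hz] with w hw
    have := (hc hG.continuousOn hw).aestronglyMeasurable
    rwa [uIoc_of_le zero_le_one]
  · have : IntervalIntegrable (fun u : ℝ => deriv G (z * u) * u) volume 0 1 := by
      apply (hc hG' hz).mul_continuousOn
      fun_prop
    have := this.aestronglyMeasurable
    rwa [uIoc_of_le zero_le_one]
  · refine Eventually.of_forall fun u hu w hw => ?_
    have hu' := huI u hu
    have h1 := hC (w * u) ⟨(w, u), ⟨hw, hu'⟩, rfl⟩
    have h2 : ‖(u : ℂ)‖ ≤ 1 := by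
      rw [Complex.norm_real, Real.norm_of_nonneg hu'.1]
      exact hu'.2
    rw [norm_mul]
    exact (mul_le_of_le_one_right (norm_nonneg _) h2).trans h1
  · refine Eventually.of_forall fun u hu w hw => ?_
    have h1 : HasDerivAt G (deriv G (w * u)) (w * u) :=
      (hG.differentiableAt (isOpen_cutPlane.mem_nhds
        (mul_ofReal_mem_cutPlane (hball hw) (huI u hu)))).hasDerivAt
    exact (h1.comp w ((hasDerivAt_id w).mul_const (u : ℂ))).congr_deriv (by rw [one_mul])

theorem differentiableOn_segmentAverage {G : ℂ → ℂ} (hG : DifferentiableOn ℂ G cutPlane) :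
    DifferentiableOn ℂ (segmentAverage G) cutPlane := fun _ hz =>
  (hasDerivAt_segmentAverage hG hz).differentiableAt.differentiableWithinAt

/-- The product rule produces the integral of `G(zu) + z u G'(zu)`, which is the `u`-derivative of
`u G(zu)`; its increment over `[0, 1]` is `G(z)`. -/
theorem hasDerivAt_mul_segmentAverage {G : ℂ → ℂ} (hG : DifferentiableOn ℂ G cutPlane) {z : ℂ}
    (hz : z ∈ cutPlane) : HasDerivAt (fun w => w * segmentAverage G w) (G z) z := by
  have h := (hasDerivAt_id z).mul (hasDerivAt_segmentAverage hG hz)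
  refine h.congr_deriv ?_
  have hG' : ContinuousOn (deriv G) cutPlane := (hG.deriv isOpen_cutPlane).continuousOn
  have huI : ∀ u ∈ uIcc (0 : ℝ) 1, u ∈ Icc (0 : ℝ) 1 := fun u hu => by
    rwa [uIcc_of_le zero_le_one] at hu
  have hd : ∀ u ∈ uIcc (0 : ℝ) 1, HasDerivAt (fun u : ℝ => (u : ℂ) * G (z * u))
      (G (z * u) + z * (deriv G (z * u) * u)) u := fun u hu => by
    have h1 : HasDerivAt G (deriv G (z * u)) (z * u) :=
      (hG.differentiableAt (isOpen_cutPlane.mem_nhds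
        (mul_ofReal_mem_cutPlane hz (huI u hu)))).hasDerivAt
    have h2 : HasDerivAt (fun u : ℂ => u * G (z * u)) (G (z * u) + z * (deriv G (z * u) * u))
        (u : ℂ) := by
      have h3 : HasDerivAt (fun u : ℂ => z * u) z (u : ℂ) := by
        simpa using (hasDerivAt_id (u : ℂ)).const_mul z
      refine ((hasDerivAt_id (u : ℂ)).mul (h1.comp (u : ℂ) h3)).congr_deriv ?_
      simp only [id, Function.comp]
      ring
    exact h2.comp_ofReal
  have hi1 : IntervalIntegrable (fun u : ℝ => G (z * u)) volume 0 1 := by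
    apply ContinuousOn.intervalIntegrable
    rw [uIcc_of_le zero_le_one]
    exact continuous_comp_mul_ofReal hG.continuousOn hz
  have hi2 : IntervalIntegrable (fun u : ℝ => z * (deriv G (z * u) * u)) volume 0 1 := by
    apply ContinuousOn.intervalIntegrable
    rw [uIcc_of_le zero_le_one]
    exact continuousOn_const.mul
      ((continuous_comp_mul_ofReal hG' hz).mul (by fun_prop))
  have hint := intervalIntegral.integral_eq_sub_of_hasDerivAt hd (hi1.add hi2)
  rw [intervalIntegral.integral_add hi1 hi2, intervalIntegral.integral_const_mul] at hint
  simp only [Complex.ofReal_one, mul_one, one_mul, Complex.ofReal_zero, zero_mul, sub_zero] at hint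
  rw [← hint]
  simp [segmentAverage]

/-- The function `Li_q(z) / z` on the slit plane, for `q ≥ 0`. -/
noncomputable def polylogDiv : ℕ → ℂ → ℂ
  | 0 => fun z => (1 - z)⁻¹
  | q + 1 => segmentAverage (polylogDiv q)

theorem differentiableOn_polylogDiv (q : ℕ) : DifferentiableOn ℂ (polylogDiv q) cutPlane := by
  induction q with
  | zero =>
    exact (differentiableOn_const 1 |>.sub differentiableOn_id).inv
      fun z hz => one_sub_ne_zero_of_mem_cutPlane hz
  | succ q ih => exact differentiableOn_segmentAverage ih

/-- Each average is integrated term by term, with `‖z‖ ^ j` as dominating series; `∫ u^j = 1 / (j +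
1)` raises the exponent by one. -/
theorem hasSum_polylogDiv (q : ℕ) {z : ℂ} (hz : ‖z‖ < 1) :
    HasSum (fun j : ℕ => z ^ j / ((j : ℂ) + 1) ^ q) (polylogDiv q z) := by
  induction q generalizing z with
  | zero => simpa [polylogDiv] using hasSum_geometric_of_norm_lt_one hz
  | succ q ih =>
    have hnorm : ∀ u ∈ uIoc (0 : ℝ) 1, ‖(u : ℂ)‖ ≤ 1 ∧ ‖z * u‖ < 1 := fun u hu => by
      rw [uIoc_of_le zero_le_one] at hu
      have h2 : ‖(u : ℂ)‖ ≤ 1 := by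
        rw [Complex.norm_real, Real.norm_of_nonneg hu.1.le]
        exact hu.2
      refine ⟨h2, ?_⟩
      rw [norm_mul]
      exact (mul_le_of_le_one_right (norm_nonneg _) h2).trans_lt hz
    have h := intervalIntegral.hasSum_integral_of_dominated_convergence (a := 0) (b := 1)
      (μ := volume) (F := fun (j : ℕ) (u : ℝ) => (z * u) ^ j / ((j : ℂ) + 1) ^ q)
      (f := fun u : ℝ => polylogDiv q (z * u)) (fun j _ => ‖z‖ ^ j)
      (fun j => by
        apply Continuous.aestronglyMeasurable
        fun_prop)
      (fun j => Eventually.of_forall fun u hu => by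
        rw [norm_div, norm_pow, norm_mul, mul_pow, norm_pow]
        have h1 : (1 : ℝ) ≤ ‖(j : ℂ) + 1‖ ^ q := by
          apply one_le_pow₀
          have : (j : ℂ) + 1 = ((j + 1 : ℕ) : ℂ) := by push_cast; ring
          rw [this, Complex.norm_natCast]
          simp
        refine (div_le_self (by positivity) h1).trans ?_
        exact mul_le_of_le_one_right (by positivity) (pow_le_one₀ (norm_nonneg _) (hnorm u hu).1))
      (Eventually.of_forall fun u _ => summable_geometric_of_lt_one (norm_nonneg _) hz)
      (by simp)
      (Eventually.of_forall fun u hu => ih (hnorm u hu).2)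
    refine Eq.mp (congrArg (fun f => HasSum f _) (funext fun j => ?_)) h
    have : ∫ u in (0 : ℝ)..1, (u : ℂ) ^ j = 1 / ((j : ℂ) + 1) := by
      have h := congrArg (fun x : ℝ => (x : ℂ)) (integral_pow (a := 0) (b := 1) j)
      rw [← intervalIntegral.integral_ofReal] at h
      simpa using h
    have hF : (fun u : ℝ => (z * u) ^ j / ((j : ℂ) + 1) ^ q) =
        fun u : ℝ => z ^ j / ((j : ℂ) + 1) ^ q * (u : ℂ) ^ j := by
      funext u
      ring
    rw [hF, intervalIntegral.integral_const_mul, this, pow_succ, div_mul_div_comm, mul_one]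

/-! ### Polylogarithms of nonpositive order -/

/-- The coefficient `p! [t ^ p] (1 - e^{-t}) ^ j`, through its recursion. -/
def polyBernoulliCoeff : ℕ → ℕ → ℤ
  | 0, 0 => 1
  | 0, _ + 1 => 0
  | _ + 1, 0 => 0
  | p + 1, j + 1 => (j + 1) * (polyBernoulliCoeff p j - polyBernoulliCoeff p (j + 1))

theorem polyBernoulliCoeff_eq_zero {p j : ℕ} (h : p < j) : polyBernoulliCoeff p j = 0 := by
  induction p generalizing j with
  | zero =>
    cases j with
    | zero => omega
    | succ j => rfl
  | succ p ih =>
    cases j with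
    | zero => omega
    | succ j => rw [polyBernoulliCoeff, ih (by omega), ih (by omega)]; simp

/-- Summation by parts: the recursion of the coefficients is transferred to `f`. The boundary term
vanishes because the coefficient at `(p, p + 1)` is zero. -/
theorem sum_polyBernoulliCoeff_succ {R : Type*} [CommRing R] (p : ℕ) (f : ℕ → R) :
    ∑ j ∈ Finset.range (p + 2), (polyBernoulliCoeff (p + 1) j : R) * f j =
      ∑ j ∈ Finset.range (p + 1), (polyBernoulliCoeff p j : R) *
        (((j : R) + 1) * f (j + 1) - (j : R) * f j) := by
  have h1 : ∑ j ∈ Finset.range (p + 1), ((j : R) + 1) * polyBernoulliCoeff p (j + 1) * f (j + 1) =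
      ∑ j ∈ Finset.range (p + 1), (j : R) * polyBernoulliCoeff p j * f j := by
    have h2 := Finset.sum_range_succ' (fun j => (j : R) * polyBernoulliCoeff p j * f j) (p + 1)
    rw [Finset.sum_range_succ, polyBernoulliCoeff_eq_zero (Nat.lt_succ_self p)] at h2
    simpa using h2.symm
  rw [Finset.sum_range_succ']
  simp only [polyBernoulliCoeff, Int.cast_zero, zero_mul, add_zero]
  rw [← sub_eq_zero, ← Finset.sum_sub_distrib]
  rw [← sub_eq_zero, ← Finset.sum_sub_distrib] at h1
  rw [← neg_eq_zero, ← Finset.sum_neg_distrib, ← h1]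
  refine Finset.sum_congr rfl fun j _ => ?_
  push_cast
  ring

/-- Since `(j + 1) C(N+j+1, j+1) = (N + j + 1) C(N+j, j)`, each step in `p` multiplies the sum by `N
+ 1`. The binomial is the coefficient of `z^N` in `(1 - z)^{-(j+1)}`, which is how the identity is
used. -/
theorem sum_polyBernoulliCoeff_mul_choose (p N : ℕ) :
    ∑ j ∈ Finset.range (p + 1), (polyBernoulliCoeff p j : ℂ) * ((N + j).choose j : ℂ) =
      ((N : ℂ) + 1) ^ p := by
  induction p with
  | zero => simp [polyBernoulliCoeff]
  | succ p ih =>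
    rw [sum_polyBernoulliCoeff_succ p fun j => ((N + j).choose j : ℂ), pow_succ, ← ih,
      Finset.sum_mul]
    refine Finset.sum_congr rfl fun j _ => ?_
    have h : ((N + j + 1 : ℕ) : ℂ) * ((N + j).choose j : ℂ) =
        ((N + (j + 1)).choose (j + 1) : ℂ) * ((j + 1 : ℕ) : ℂ) := by
      exact_mod_cast Nat.add_one_mul_choose_eq (N + j) j
    push_cast at h
    linear_combination -(polyBernoulliCoeff p j : ℂ) * h

/-- The function `Li_{-p}(z) / z` on the slit plane, for `p ≥ 0`. -/
noncomputable def polylogDivNeg (p : ℕ) (z : ℂ) : ℂ :=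
  ∑ j ∈ Finset.range (p + 1), (polyBernoulliCoeff p j : ℂ) * (1 / (1 - z) ^ (j + 1))

theorem differentiableOn_polylogDivNeg (p : ℕ) :
    DifferentiableOn ℂ (polylogDivNeg p) cutPlane := by
  refine DifferentiableOn.fun_sum fun j _ => ?_
  refine (differentiableOn_const _).mul ((differentiableOn_const _).div ?_ fun z hz =>
    pow_ne_zero _ (one_sub_ne_zero_of_mem_cutPlane hz))
  fun_prop

theorem hasSum_polylogDivNeg (p : ℕ) {z : ℂ} (hz : ‖z‖ < 1) :
    HasSum (fun j : ℕ => z ^ j * ((j : ℂ) + 1) ^ p) (polylogDivNeg p z) := by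
  have h := hasSum_sum (s := Finset.range (p + 1)) fun j _ =>
    (hasSum_choose_mul_geometric_of_norm_lt_one j hz).mul_left (polyBernoulliCoeff p j : ℂ)
  refine Eq.mp (congrArg (fun f => HasSum f _) (funext fun N => ?_)) h
  symm
  rw [← sum_polyBernoulliCoeff_mul_choose, Finset.mul_sum]
  exact Finset.sum_congr rfl fun j _ => by ring

/-- The function `Li_q(z) / z` on the slit plane, for `q ∈ ℤ`. -/
noncomputable def polylogDivInt : ℤ → ℂ → ℂ
  | .ofNat q => polylogDiv q
  | .negSucc p => polylogDivNeg (p + 1)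

theorem polylogDivInt_natCast (q : ℕ) : polylogDivInt q = polylogDiv q := rfl

theorem polylogDivInt_neg_natCast (p : ℕ) : polylogDivInt (-(p : ℤ)) = polylogDivNeg p := by
  cases p with
  | zero =>
    funext z
    change polylogDiv 0 z = _
    simp [polylogDivNeg, polylogDiv, polyBernoulliCoeff]
  | succ p => rfl

theorem differentiableOn_polylogDivInt (q : ℤ) :
    DifferentiableOn ℂ (polylogDivInt q) cutPlane := by
  cases q with
  | ofNat q => exact differentiableOn_polylogDiv q
  | negSucc p => exact differentiableOn_polylogDivNeg (p + 1)

theorem hasSum_polylogDivInt (q : ℤ) {z : ℂ} (hz : ‖z‖ < 1) :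
    HasSum (fun j : ℕ => z ^ j * ((j : ℂ) + 1) ^ (-q)) (polylogDivInt q z) := by
  cases q with
  | ofNat q =>
    simpa [zpow_neg, div_eq_mul_inv, polylogDivInt] using hasSum_polylogDiv q hz
  | negSucc p =>
    simpa only [Int.neg_negSucc, zpow_natCast, polylogDivInt] using hasSum_polylogDivNeg (p + 1) hz

/-! ### Faulhaber's formula and the double polylogarithm -/

theorem sum_pow_eq_faulhaberD (n : ℕ) {N : ℕ} (hN : 0 < N) :
    ∑ i ∈ Finset.range N with 0 < i, (i : ℂ) ^ n =
      ∑ l ∈ Finset.Icc 0 (n + 1), faulhaberD n l * (N : ℂ) ^ l := by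
  have hI : Finset.Icc 0 (n + 1) = Finset.range (n + 1 + 1) := by
    ext l
    simp
  rw [hI, Finset.sum_range_succ']
  rcases Nat.eq_zero_or_pos n with rfl | hn
  -- For `n = 0` the excluded index `0` would contribute `0 ^ 0 = 1`; this is the origin of `D_0 =
  -- -1`.
  · have : (Finset.range N).filter (0 < ·) = (Finset.range N).erase 0 := by
      ext i
      simp
      omega
    rw [this]
    simp [faulhaberD, Finset.card_erase_of_mem, hN, Nat.cast_sub (Nat.one_le_of_lt hN)]
    ring
  · have h0 : faulhaberD n 0 = 0 := by simp [faulhaberD, hn.ne']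
    have h1 : ∑ i ∈ Finset.range N with 0 < i, (i : ℂ) ^ n =
        ∑ i ∈ Finset.range N, (i : ℂ) ^ n := by
      apply Finset.sum_filter_of_ne
      intro i _ hi
      by_contra h
      have : i = 0 := by omega
      subst this
      simp [hn.ne'] at hi
    have h2 := congrArg (fun x : ℚ => (x : ℂ)) (sum_range_pow N n)
    push_cast at h2
    -- `sum_range_pow` is indexed by the Bernoulli index `e`, here by the power `l = j + 1` with `j
    -- + e = n`. The case `e = 0` is the leading coefficient `1 / (n + 1)`; the others are zeta
    -- values.
    rw [h0, zero_mul, add_zero, h1, h2, ← Finset.sum_range_reflect]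
    refine Finset.sum_congr rfl fun j hj => ?_
    have hj' : j ≤ n := by simpa [Nat.lt_succ_iff] using hj
    obtain ⟨e, rfl⟩ := Nat.exists_eq_add_of_le hj'
    have e1 : j + e + 1 - 1 - j = e := by omega
    have e2 : j + e + 1 - e = j + 1 := by omega
    rw [e1, e2]
    cases e with
    | zero => simp [faulhaberD]; ring
    | succ e =>
      have e3 : j + (e + 1) - (j + 1) = e := by omega
      have e4 : -((j + (e + 1) : ℕ) : ℂ) + ((j + 1 : ℕ) : ℂ) = -(e : ℂ) := by push_cast; ring
      have e5 : ((j + (e + 1)).choose (j + 1) : ℂ) = ((j + (e + 1)).choose e : ℂ) := by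
        rw [← Nat.choose_symm_of_eq_add (by omega : j + (e + 1) = e + (j + 1))]
      have hc : ((j + (e + 1) + 1 : ℕ) : ℂ) * ((j + (e + 1)).choose e : ℂ) =
          ((j + (e + 1) + 1).choose (e + 1) : ℂ) * ((e + 1 : ℕ) : ℂ) := by
        exact_mod_cast Nat.add_one_mul_choose_eq (j + (e + 1)) e
      rw [faulhaberD, if_neg (by omega), if_neg (by omega), e3, e4, e5,
        riemannZeta_neg_nat_eq_bernoulli]
      have hs : ((-1 : ℂ) ^ e) * (-1) ^ e = 1 := by
        rw [← mul_pow]; simp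
      have d1 : ((j : ℂ) + ((e : ℂ) + 1) + 1) ≠ 0 := by
        exact_mod_cast Nat.succ_ne_zero (j + (e + 1))
      have d2 : (e : ℂ) + 1 ≠ 0 := by exact_mod_cast Nat.succ_ne_zero e
      push_cast at hc ⊢
      field_simp
      linear_combination (-(bernoulli (e + 1) : ℂ) * N ^ (j + 1)) * hc
        - (bernoulli (e + 1) : ℂ) * ((j + (e + 1)).choose e : ℂ) *
          ((j : ℂ) + (e + 1) + 1) * N ^ (j + 1) * hs

theorem summable_indicator_doublePolylog (n k : ℕ) {z : ℂ} (hz : ‖z‖ < 1) :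
    Summable ({p : ℕ × ℕ | 0 < p.1 ∧ p.1 < p.2}.indicator fun p : ℕ × ℕ =>
      z ^ p.2 / ((p.1 : ℂ) ^ (-(n : ℤ)) * (p.2 : ℂ) ^ (k : ℤ))) := by
  -- For `m₁ < m₂`, `‖z‖ ^ m₂ = r ^ m₂ * r ^ m₂ ≤ r ^ m₁ * r ^ m₂`, so the square root splits the
  -- bound into a product of two convergent series.
  set r := √‖z‖ with hr
  have hr0 : 0 ≤ r := Real.sqrt_nonneg _
  have hr1 : r < 1 := by
    rw [hr, Real.sqrt_lt' one_pos]
    simpa using hz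
  have hrr : ‖z‖ = r * r := (Real.mul_self_sqrt (norm_nonneg _)).symm
  have hnr : ‖r‖ < 1 := by rwa [Real.norm_of_nonneg hr0]
  have hs : Summable fun p : ℕ × ℕ => ((p.1 : ℝ) ^ n * r ^ p.1) * r ^ p.2 :=
    (summable_pow_mul_geometric_of_norm_lt_one n hnr).mul_of_nonneg
      (summable_geometric_of_lt_one hr0 hr1) (fun _ => by positivity) fun _ => by positivity
  refine hs.of_norm_bounded fun p => ?_
  by_cases hp : p ∈ {p : ℕ × ℕ | 0 < p.1 ∧ p.1 < p.2}
  · rw [indicator_of_mem hp]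
    obtain ⟨h1, h2⟩ := hp
    have h3 : (1 : ℝ) ≤ (p.2 : ℝ) ^ k := one_le_pow₀ (by exact_mod_cast (by omega : 1 ≤ p.2))
    rw [zpow_neg, zpow_natCast, zpow_natCast, norm_div, norm_mul, norm_inv, norm_pow, norm_pow,
      norm_pow, Complex.norm_natCast, Complex.norm_natCast, ← div_div, div_inv_eq_mul, hrr, mul_pow]
    refine (div_le_self (by positivity) h3).trans ?_
    have h4 : r ^ p.2 ≤ r ^ p.1 := pow_le_pow_of_le_one hr0 hr1.le h2.le
    calc r ^ p.2 * r ^ p.2 * (p.1 : ℝ) ^ n ≤ r ^ p.1 * r ^ p.2 * (p.1 : ℝ) ^ n := by gcongr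
      _ = _ := by ring
  · rw [indicator_of_notMem hp, norm_zero]
    positivity

/-- Absolute convergence allows the double series to be grouped by the outer index; uniqueness of
sums then identifies its value. -/
theorem hasSum_doublePolylog_of_hasSum (n k : ℕ) {z A : ℂ} (hz : ‖z‖ < 1)
    (hA : HasSum (fun N : ℕ => z ^ N / (N : ℂ) ^ k *
      ∑ i ∈ Finset.range N with 0 < i, (i : ℂ) ^ n) A) :
    HasSum (fun p : DoublePolylogIndex =>
        z ^ p.1.2 / ((p.1.1 : ℂ) ^ (-(n : ℤ)) * (p.1.2 : ℂ) ^ (k : ℤ))) A := by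
  obtain ⟨S, hs⟩ := summable_indicator_doublePolylog n k hz
  have h2 : HasSum (fun N : ℕ => z ^ N / (N : ℂ) ^ k *
      ∑ i ∈ Finset.range N with 0 < i, (i : ℂ) ^ n) S := by
    refine ((Equiv.prodComm ℕ ℕ).hasSum_iff.2 hs).prod_fiberwise fun N => ?_
    convert hasSum_sum_of_ne_finset_zero (s := {i ∈ Finset.range N | 0 < i}) ?_ using 1
    · rw [Finset.mul_sum]
      refine Finset.sum_congr rfl fun i hi => ?_
      rw [Finset.mem_filter, Finset.mem_range] at hi
      rw [Function.comp_apply, Equiv.prodComm_apply, Prod.swap_prod_mk,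
        indicator_of_mem (by exact ⟨hi.2, hi.1⟩), zpow_neg, zpow_natCast, zpow_natCast,
        ← div_div, div_inv_eq_mul]
      ring
    · intro i hi
      rw [Finset.mem_filter, Finset.mem_range] at hi
      rw [Function.comp_apply, Equiv.prodComm_apply, Prod.swap_prod_mk, indicator_of_notMem]
      exact fun h => hi ⟨h.2, h.1⟩
    · infer_instance
  rw [← hA.unique h2] at hs
  exact hasSum_subtype_iff_indicator.2 hs

/-- `Li_{-n,k}` as a linear combination of polylogarithms. -/
noncomputable def doublePolylogSum (n k : ℕ) (z : ℂ) : ℂ :=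
  ∑ l ∈ Finset.Icc 0 (n + 1), faulhaberD n l * (z * polylogDivInt ((k : ℤ) - l) z)

theorem isDoublePolylog_doublePolylogSum (n k : ℕ) :
    IsDoublePolylog (-(n : ℤ)) k (doublePolylogSum n k) := by
  refine ⟨DifferentiableOn.fun_sum fun l _ => (differentiableOn_const _).mul
    (differentiableOn_id.mul (differentiableOn_polylogDivInt _)), fun z hz => ?_⟩
  refine hasSum_doublePolylog_of_hasSum n k hz ?_
  -- The term `N = 0` has an empty inner sum; dropping it aligns the indices with the series of
  -- `Li_q(z) / z`.
  rw [← hasSum_nat_add_iff' 1]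
  simp only [Finset.range_one, Finset.sum_singleton, Finset.range_zero, Finset.filter_empty,
    Finset.sum_empty, mul_zero, sub_zero]
  have h := hasSum_sum (s := Finset.Icc 0 (n + 1)) fun l _ =>
    ((hasSum_polylogDivInt ((k : ℤ) - l) hz).mul_left z).mul_left (faulhaberD n l)
  refine Eq.mp (congrArg (fun f => HasSum f _) (funext fun j => ?_)) h
  symm
  have hj : (j : ℂ) + 1 ≠ 0 := by exact_mod_cast Nat.succ_ne_zero j
  rw [sum_pow_eq_faulhaberD n (Nat.succ_pos j), Finset.mul_sum]
  refine Finset.sum_congr rfl fun l _ => ?_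
  rw [neg_sub, zpow_sub₀ hj, zpow_natCast, zpow_natCast]
  push_cast
  ring

theorem isDoublePolylog_doublePolylog (n k : ℕ) :
    IsDoublePolylog (-(n : ℤ)) k (doublePolylog (-(n : ℤ)) k) :=
  Classical.epsilon_spec ⟨_, isDoublePolylog_doublePolylogSum n k⟩

/-- By the identity theorem from the unit disc, the function picked by `Classical.epsilon` agrees on
the slit plane with the explicit `doublePolylogSum`. -/
theorem IsDoublePolylog.eqOn {k₁ k₂ : ℤ} {F G : ℂ → ℂ} (hF : IsDoublePolylog k₁ k₂ F)
    (hG : IsDoublePolylog k₁ k₂ G) : EqOn F G cutPlane := by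
  refine (hF.1.analyticOnNhd isOpen_cutPlane).eqOn_of_preconnected_of_eventuallyEq
    (hG.1.analyticOnNhd isOpen_cutPlane) isPreconnected_cutPlane zero_mem_cutPlane ?_
  filter_upwards [Metric.ball_mem_nhds (0 : ℂ) one_pos] with z hz
  rw [mem_ball_zero_iff] at hz
  exact (hF.2 z hz).unique (hG.2 z hz)

/-! ### Restriction to `z = 1 - e^t`: positivity, integral recursion, decay -/

theorem exists_polylogDiv_ofReal (q : ℕ) {x : ℝ} (hx : x < 1) :
    ∃ r : ℝ, 0 ≤ r ∧ polylogDiv q x = r := by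
  induction q generalizing x with
  | zero =>
    refine ⟨(1 - x)⁻¹, inv_nonneg.2 (by linarith), ?_⟩
    simp [polylogDiv]
  | succ q ih =>
    have hlt : ∀ u ∈ Icc (0 : ℝ) 1, x * u < 1 := fun u hu => by
      rcases le_or_gt x 0 with h | h
      · nlinarith [hu.1]
      · nlinarith [hu.2]
    refine ⟨∫ u in (0 : ℝ)..1, (polylogDiv q (x * u)).re, ?_, ?_⟩
    · refine intervalIntegral.integral_nonneg zero_le_one fun u hu => ?_
      obtain ⟨r, hr, h⟩ := ih (hlt u hu)
      rw [← Complex.ofReal_mul, h]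
      exact hr
    · rw [← intervalIntegral.integral_ofReal, polylogDiv, segmentAverage]
      refine intervalIntegral.integral_congr fun u hu => ?_
      rw [uIcc_of_le zero_le_one] at hu
      obtain ⟨r, hr, h⟩ := ih (hlt u hu)
      rw [← Complex.ofReal_mul, h, Complex.ofReal_re]

/-- The real function `t ↦ Li_q(1 - e ^ t) / (1 - e ^ t)`. -/
noncomputable def polylogReal (q : ℕ) (t : ℝ) : ℝ := (polylogDiv q (1 - Complex.exp t)).re

theorem polylogDiv_one_sub_exp (q : ℕ) (t : ℝ) :
    polylogDiv q (1 - Complex.exp t) = polylogReal q t := by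
  obtain ⟨r, -, h⟩ := exists_polylogDiv_ofReal q (x := 1 - Real.exp t)
    (by linarith [Real.exp_pos t])
  push_cast at h
  rw [polylogReal, h, Complex.ofReal_re]

theorem polylogReal_nonneg (q : ℕ) (t : ℝ) : 0 ≤ polylogReal q t := by
  obtain ⟨r, hr, h⟩ := exists_polylogDiv_ofReal q (x := 1 - Real.exp t)
    (by linarith [Real.exp_pos t])
  push_cast at h
  rw [polylogReal, h, Complex.ofReal_re]
  exact hr

theorem continuous_polylogReal (q : ℕ) : Continuous (polylogReal q) :=
  Complex.continuous_re.comp ((differentiableOn_polylogDiv q).continuousOn.comp_continuous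
    (by fun_prop) one_sub_exp_mem_cutPlane)

theorem polylogReal_zero (t : ℝ) : polylogReal 0 t = Real.exp (-t) := by
  change ((1 - (1 - Complex.exp (t : ℂ)))⁻¹).re = _
  rw [sub_sub_cancel, ← Complex.exp_neg, ← Complex.ofReal_neg,
    Complex.exp_ofReal_re]

/-- This is `hasDerivAt_mul_segmentAverage` under the substitution `z = 1 - e^x`, integrated from `x
= 0`, where `z` vanishes. -/
theorem integral_exp_mul_polylogReal (q : ℕ) (t : ℝ) :
    ∫ x in (0 : ℝ)..t, Real.exp x * polylogReal q x =
      (Real.exp t - 1) * polylogReal (q + 1) t := by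
  have hd : ∀ x ∈ uIcc 0 t, HasDerivAt (fun x => (Real.exp x - 1) * polylogReal (q + 1) x)
      (Real.exp x * polylogReal q x) x := fun x _ => by
    have h1 := hasDerivAt_mul_segmentAverage (differentiableOn_polylogDiv q)
      (one_sub_exp_mem_cutPlane x)
    have h2 : HasDerivAt (fun w : ℂ => 1 - Complex.exp w) (-Complex.exp x) (x : ℂ) :=
      (Complex.hasDerivAt_exp (x : ℂ)).const_sub 1
    have h3 := ((h1.comp (x : ℂ) h2).neg).real_of_complex
    have e : (fun x : ℝ => (Real.exp x - 1) * polylogReal (q + 1) x) = fun x : ℝ =>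
        ((-((fun w => w * segmentAverage (polylogDiv q) w) ∘ fun w : ℂ => 1 - Complex.exp w)) x).re
        := by
      funext y
      have h4 : segmentAverage (polylogDiv q) (1 - Complex.exp y) = polylogReal (q + 1) y :=
        polylogDiv_one_sub_exp (q + 1) y
      simp only [Pi.neg_apply, Function.comp_apply]
      rw [h4, ← Complex.ofReal_exp, ← Complex.ofReal_one, ← Complex.ofReal_sub,
        ← Complex.ofReal_mul, ← Complex.ofReal_neg, Complex.ofReal_re]
      ring
    rw [e]
    refine h3.congr_deriv ?_
    rw [polylogDiv_one_sub_exp, ← Complex.ofReal_exp, ← Complex.ofReal_neg, ← Complex.ofReal_mul,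
        ← Complex.ofReal_neg, Complex.ofReal_re]
    ring
  rw [intervalIntegral.integral_eq_sub_of_hasDerivAt hd
    ((Real.continuous_exp.mul (continuous_polylogReal q)).intervalIntegrable _ _)]
  simp

/-- Inserting the bound for `q` into the integral recursion gives `2 ^ (q + 1) (e^{t/2} - 1)`;
dividing by `e^t - 1 = (e^{t/2} - 1)(e^{t/2} + 1)` returns a bound of the same form. Only
integrability matters, so the rate `1/2` is not optimised. -/
theorem polylogReal_le (q : ℕ) {t : ℝ} (ht : 0 < t) :
    polylogReal q t ≤ 2 ^ q * Real.exp (-(t / 2)) := by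
  induction q generalizing t with
  | zero =>
    rw [polylogReal_zero, pow_zero, one_mul, Real.exp_le_exp]
    linarith
  | succ q ih =>
    have h1 : ∫ x in (0 : ℝ)..t, Real.exp x * polylogReal q x ≤
        ∫ x in (0 : ℝ)..t, 2 ^ q * Real.exp (x / 2) := by
      refine intervalIntegral.integral_mono_on_of_le_Ioo ht.le
        ((Real.continuous_exp.mul (continuous_polylogReal q)).intervalIntegrable _ _)
        (Continuous.intervalIntegrable (by fun_prop) _ _) fun x hx => ?_
      have := mul_le_mul_of_nonneg_left (ih hx.1) (Real.exp_pos x).le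
      refine this.trans (le_of_eq ?_)
      rw [mul_left_comm, ← Real.exp_add]
      ring_nf
    have h2 : ∫ x in (0 : ℝ)..t, 2 ^ q * Real.exp (x / 2) =
        2 ^ (q + 1) * (Real.exp (t / 2) - 1) := by
      rw [intervalIntegral.integral_eq_sub_of_hasDerivAt
        (f := fun x => 2 ^ (q + 1) * Real.exp (x / 2)) _
        (Continuous.intervalIntegrable (by fun_prop) _ _)]
      · simp; ring
      · intro x _
        refine (((hasDerivAt_id x).div_const 2).exp.const_mul (2 ^ (q + 1) : ℝ)).congr_deriv ?_
        simp only [id]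
        ring
    rw [integral_exp_mul_polylogReal, h2] at h1
    set a := Real.exp (t / 2) with ha
    have ha1 : 1 < a := Real.one_lt_exp_iff.2 (by linarith)
    have he : Real.exp t = a * a := by rw [ha, ← Real.exp_add]; ring_nf
    rw [he] at h1
    rw [Real.exp_neg, ← ha, ← div_eq_mul_inv, le_div_iff₀ (by linarith)]
    have h3 : (a + 1) * polylogReal (q + 1) t ≤ 2 ^ (q + 1) := by
      have : (a - 1) * ((a + 1) * polylogReal (q + 1) t) ≤ (a - 1) * 2 ^ (q + 1) := by
        linarith
      exact le_of_mul_le_mul_left this (by linarith)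
    linarith [polylogReal_nonneg (q + 1) t]

/-! ### Incomplete gamma integrals and Tonelli's theorem -/

/-- `∫ t in (x, ∞), t ^ b / b! * e ^ {-c t}` in closed form. -/
noncomputable def incompleteGamma (c : ℝ) (b : ℕ) (x : ℝ) : ℝ :=
  ∑ p ∈ Finset.HasAntidiagonal.antidiagonal b, x ^ p.2 / (p.2.factorial : ℝ) * Real.exp (-c * x) / c ^ (p.1 + 1)

theorem incompleteGamma_succ (c : ℝ) (b : ℕ) (x : ℝ) :
    incompleteGamma c (b + 1) x =
      x ^ (b + 1) / ((b + 1).factorial : ℝ) * Real.exp (-c * x) / c + incompleteGamma c b x / c := by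
  rw [incompleteGamma, Finset.Nat.antidiagonal_succ, Finset.sum_cons, Finset.sum_map]
  simp only [zero_add, pow_one]
  rw [incompleteGamma, Finset.sum_div]
  congr 1
  refine Finset.sum_congr rfl fun p _ => ?_
  simp only [Function.Embedding.prodMap, Function.Embedding.coeFn_mk, Prod.map,
    Function.Embedding.refl_apply, Nat.succ_eq_add_one]
  rw [div_div, ← pow_succ]

/-- By induction through `incompleteGamma_succ`: differentiating the new monomial produces a term
that cancels the derivative of the previous sum. -/
theorem hasDerivAt_incompleteGamma {c : ℝ} (hc : 0 < c) (b : ℕ) (x : ℝ) :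
    HasDerivAt (incompleteGamma c b) (-(x ^ b / (b.factorial : ℝ) * Real.exp (-c * x))) x := by
  have he : HasDerivAt (fun x => Real.exp (-c * x)) (Real.exp (-c * x) * -c) x := by
    simpa using ((hasDerivAt_id x).const_mul (-c)).exp
  induction b with
  | zero =>
    have e : incompleteGamma c 0 = fun x => Real.exp (-c * x) / c := by
      funext y
      simp [incompleteGamma]
    rw [e]
    refine (he.div_const c).congr_deriv ?_
    simp
    field_simp
  | succ b ih =>
    have e : incompleteGamma c (b + 1) = fun x =>
        x ^ (b + 1) / ((b + 1).factorial : ℝ) * Real.exp (-c * x) / c + incompleteGamma c b x / c :=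
      funext fun y => incompleteGamma_succ c b y
    rw [e]
    refine ((((((hasDerivAt_pow (b + 1) x).div_const ((b + 1).factorial : ℝ)).mul he).div_const
      c).add (ih.div_const c)).congr_deriv ?_)
    rw [Nat.factorial_succ]
    have : (b.factorial : ℝ) ≠ 0 := by exact_mod_cast b.factorial_ne_zero
    push_cast
    field_simp
    simp

theorem tendsto_incompleteGamma {c : ℝ} (hc : 0 < c) (b : ℕ) :
    Tendsto (incompleteGamma c b) atTop (𝓝 0) := by
  have h : Tendsto (fun x => ∑ p ∈ Finset.HasAntidiagonal.antidiagonal b, x ^ p.2 * Real.exp (-c * x) *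
      ((p.2.factorial : ℝ) * c ^ (p.1 + 1))⁻¹) atTop
      (𝓝 (∑ p ∈ Finset.HasAntidiagonal.antidiagonal b, 0 * ((p.2.factorial : ℝ) * c ^ (p.1 + 1))⁻¹)) := by
    refine tendsto_finsetSum _ fun p _ => Tendsto.mul_const _ ?_
    simpa using tendsto_rpow_mul_exp_neg_mul_atTop_nhds_zero p.2 c hc
  simp only [zero_mul, Finset.sum_const_zero] at h
  refine h.congr fun x => Finset.sum_congr rfl fun p _ => ?_
  rw [mul_inv]
  ring

theorem integrableOn_pow_mul_exp {c : ℝ} (hc : 0 < c) (b : ℕ) {x : ℝ} (hx : 0 ≤ x) :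
    IntegrableOn (fun t => t ^ b / (b.factorial : ℝ) * Real.exp (-c * t)) (Ioi x) :=
  integrableOn_Ioi_deriv_of_nonneg' (g := fun t => -incompleteGamma c b t)
    (fun t _ => (hasDerivAt_incompleteGamma hc b t).neg.congr_deriv (neg_neg _))
    (fun t ht => by have : 0 < t := hx.trans_lt ht; positivity)
    (tendsto_incompleteGamma hc b).neg

theorem integral_pow_mul_exp {c : ℝ} (hc : 0 < c) (b : ℕ) {x : ℝ} (hx : 0 ≤ x) :
    ∫ t in Ioi x, t ^ b / (b.factorial : ℝ) * Real.exp (-c * t) = incompleteGamma c b x := by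
  rw [integral_Ioi_of_hasDerivAt_of_nonneg' (g := fun t => -incompleteGamma c b t)
    (fun t _ => (hasDerivAt_incompleteGamma hc b t).neg.congr_deriv (neg_neg _))
    (fun t ht => by have : 0 < t := hx.trans_lt ht; positivity)
    (tendsto_incompleteGamma hc b).neg]
  simp

theorem incompleteGamma_zero_right (c : ℝ) (b : ℕ) : incompleteGamma c b 0 = 1 / c ^ (b + 1) := by
  rw [incompleteGamma, Finset.sum_eq_single (b, 0)]
  · simp
  · rintro ⟨i, j⟩ hp hne
    rw [Finset.HasAntidiagonal.mem_antidiagonal] at hp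
    have hj : j ≠ 0 := by
      rintro rfl
      exact hne (by simpa using hp)
    simp [hj]
  · simp

theorem lintegral_pow_mul_exp {c : ℝ} (hc : 0 < c) (b : ℕ) {x : ℝ} (hx : 0 ≤ x) :
    ∫⁻ t in Ioi x, ENNReal.ofReal (t ^ b / (b.factorial : ℝ) * Real.exp (-c * t)) =
      ENNReal.ofReal (incompleteGamma c b x) := by
  rw [← integral_pow_mul_exp hc b hx, ofReal_integral_eq_lintegral_ofReal
    (integrableOn_pow_mul_exp hc b hx)]
  filter_upwards [ae_restrict_mem measurableSet_Ioi] with t ht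
  have : 0 < t := hx.trans_lt ht
  positivity

/-- Tonelli's theorem on the region `0 < x ≤ t`. -/
theorem lintegral_mul_lintegral_Ioc {f g : ℝ → ENNReal} (hf : Measurable f) (hg : Measurable g) :
    ∫⁻ t in Ioi (0 : ℝ), f t * ∫⁻ x in Ioc 0 t, g x =
      ∫⁻ x in Ioi (0 : ℝ), g x * ∫⁻ t in Ioi x, f t := by
  have hmeas : Measurable (Function.uncurry fun t x : ℝ =>
      {p : ℝ × ℝ | p.2 ≤ p.1}.indicator (fun p => f p.1 * g p.2) (t, x)) :=
    ((hf.comp measurable_fst).mul (hg.comp measurable_snd)).indicator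
      (measurableSet_le measurable_snd measurable_fst)
  have h1 : ∀ t ∈ Ioi (0 : ℝ), f t * ∫⁻ x in Ioc 0 t, g x = ∫⁻ x in Ioi (0 : ℝ),
      {p : ℝ × ℝ | p.2 ≤ p.1}.indicator (fun p => f p.1 * g p.2) (t, x) := fun t _ => by
    have e : Ioc 0 t = Iic t ∩ Ioi 0 := by
      ext x
      simp [and_comm]
    rw [e, ← Measure.restrict_restrict measurableSet_Iic, ← lintegral_const_mul _ hg,
      ← lintegral_indicator measurableSet_Iic]
    refine lintegral_congr fun x => ?_
    simp [indicator]
  have h2 : ∀ x ∈ Ioi (0 : ℝ), g x * ∫⁻ t in Ioi x, f t = ∫⁻ t in Ioi (0 : ℝ),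
      {p : ℝ × ℝ | p.2 ≤ p.1}.indicator (fun p => f p.1 * g p.2) (t, x) := fun x hx => by
    have e : Ici x = Ici x ∩ Ioi 0 := by
      ext y
      simp only [mem_inter_iff, mem_Ici, mem_Ioi, iff_self_and]
      exact fun h => lt_of_lt_of_le hx h
    -- The region `x ≤ t` has closed fibres in `t`; they differ from `Ioi x` by a null set.
    rw [Measure.restrict_congr_set Ioi_ae_eq_Ici, e, ← Measure.restrict_restrict measurableSet_Ici,
      ← lintegral_const_mul _ hf, ← lintegral_indicator measurableSet_Ici]
    refine lintegral_congr fun t => ?_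
    simp [indicator, mul_comm]
  rw [setLIntegral_congr_fun measurableSet_Ioi h1, setLIntegral_congr_fun measurableSet_Ioi h2]
  exact lintegral_lintegral_swap hmeas.aemeasurable

/-! ### Moments of polylogarithms and their recursion -/

/-- `∫ t in (0, ∞), t ^ b / b! * e ^ {-N t} * Li_q(1 - e ^ t) / (1 - e ^ t)`. -/
noncomputable def polylogMoment (q N b : ℕ) : ENNReal :=
  ∫⁻ t in Ioi (0 : ℝ),
    ENNReal.ofReal (t ^ b / (b.factorial : ℝ) * Real.exp (-(N : ℝ) * t) * polylogReal q t)

theorem polylogMoment_zero (N b : ℕ) :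
    polylogMoment 0 N b = ENNReal.ofReal (1 / ((N : ℝ) + 1) ^ (b + 1)) := by
  rw [← incompleteGamma_zero_right, ← lintegral_pow_mul_exp (by positivity) b le_rfl]
  refine lintegral_congr fun t => ?_
  rw [polylogReal_zero, mul_assoc, ← Real.exp_add]
  ring_nf

theorem hasSum_exp_neg_mul {t : ℝ} (ht : 0 < t) (N : ℕ) :
    HasSum (fun M : ℕ => Real.exp (-((N : ℝ) + M + 1) * t))
      (Real.exp (-(N : ℝ) * t) / (Real.exp t - 1)) := by
  have hlt : Real.exp (-t) < 1 := by
    rw [← Real.exp_zero, Real.exp_lt_exp]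
    linarith
  have h := (hasSum_geometric_of_lt_one (Real.exp_pos (-t)).le hlt).mul_left
    (Real.exp (-((N : ℝ) + 1) * t))
  have e1 : Real.exp (-((N : ℝ) + 1) * t) * (1 - Real.exp (-t))⁻¹ =
      Real.exp (-(N : ℝ) * t) / (Real.exp t - 1) := by
    have h1 : Real.exp (-((N : ℝ) + 1) * t) = Real.exp (-(N : ℝ) * t) / Real.exp t := by
      rw [← Real.exp_sub]
      ring_nf
    have h2 : Real.exp t - 1 ≠ 0 := by linarith [Real.add_one_le_exp t]
    have h3 := (Real.exp_pos t).ne'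
    have h4 : 1 - Real.exp (-t) = (Real.exp t - 1) / Real.exp t := by
      rw [Real.exp_neg]
      field_simp
    rw [h1, h4]
    field_simp
  rw [← e1]
  refine Eq.mp (congrArg (fun f => HasSum f _) (funext fun M => ?_)) h
  rw [← Real.exp_nat_mul, ← Real.exp_add]
  ring_nf

theorem ofReal_integrand_succ (q N b : ℕ) {t : ℝ} (ht : 0 < t) :
    ENNReal.ofReal (t ^ b / (b.factorial : ℝ) * Real.exp (-(N : ℝ) * t) * polylogReal (q + 1) t) =
      ∑' M : ℕ, ENNReal.ofReal (t ^ b / (b.factorial : ℝ) * Real.exp (-((N : ℝ) + M + 1) * t)) *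
        ∫⁻ x in Ioc 0 t, ENNReal.ofReal (Real.exp x * polylogReal q x) := by
  have hpos : 0 < Real.exp t - 1 := by linarith [Real.add_one_le_exp t]
  have hcont : Continuous fun x => Real.exp x * polylogReal q x :=
    Real.continuous_exp.mul (continuous_polylogReal q)
  have h1 : ∫⁻ x in Ioc 0 t, ENNReal.ofReal (Real.exp x * polylogReal q x) =
      ENNReal.ofReal ((Real.exp t - 1) * polylogReal (q + 1) t) := by
    rw [← integral_exp_mul_polylogReal, intervalIntegral.integral_of_le ht.le,
      ofReal_integral_eq_lintegral_ofReal (hcont.integrableOn_Icc.mono_set Ioc_subset_Icc_self)]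
    exact Eventually.of_forall fun x => mul_nonneg (Real.exp_pos x).le (polylogReal_nonneg q x)
  have h2 := (hasSum_exp_neg_mul ht N).mul_left (t ^ b / (b.factorial : ℝ))
  rw [ENNReal.tsum_mul_right, ← ENNReal.ofReal_tsum_of_nonneg (fun M => by positivity) h2.summable,
    h2.tsum_eq, h1, ← ENNReal.ofReal_mul (by positivity)]
  congr 1
  field_simp

/-- Expanding `1 / (e^t - 1)` geometrically and integrating over `t > x` first leaves an incomplete
gamma sum with rate `N + M + 1`, whose terms pair off the powers `p.1 + p.2 = b`. Working in
`ENNReal` makes all interchanges unconditional. -/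
theorem polylogMoment_succ (q N b : ℕ) :
    polylogMoment (q + 1) N b = ∑' M : ℕ, ∑ p ∈ Finset.HasAntidiagonal.antidiagonal b,
      ENNReal.ofReal (1 / ((N : ℝ) + M + 1) ^ (p.1 + 1)) * polylogMoment q (N + M) p.2 := by
  have hcont : Continuous fun x => Real.exp x * polylogReal q x :=
    Real.continuous_exp.mul (continuous_polylogReal q)
  rw [polylogMoment, setLIntegral_congr_fun measurableSet_Ioi fun t ht =>
    ofReal_integrand_succ q N b ht]
  have hF : Measurable fun t : ℝ =>
      ∫⁻ x in Ioc 0 t, ENNReal.ofReal (Real.exp x * polylogReal q x) := by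
    refine Monotone.measurable fun s t hst => ?_
    exact lintegral_mono_set (Ioc_subset_Ioc_right hst)
  have hE : ∀ M : ℕ, Measurable fun t : ℝ =>
      ENNReal.ofReal (t ^ b / (b.factorial : ℝ) * Real.exp (-((N : ℝ) + M + 1) * t)) :=
    fun M => by fun_prop
  have hEF : ∀ M : ℕ, Measurable fun t : ℝ =>
      ENNReal.ofReal (t ^ b / (b.factorial : ℝ) * Real.exp (-((N : ℝ) + M + 1) * t)) *
        ∫⁻ x in Ioc 0 t, ENNReal.ofReal (Real.exp x * polylogReal q x) :=
    fun M => (hE M).mul hF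
  rw [lintegral_tsum fun M => (hEF M).aemeasurable]
  refine tsum_congr fun M => ?_
  rw [lintegral_mul_lintegral_Ioc (hE M) hcont.measurable.ennreal_ofReal]
  have hc : (0 : ℝ) < (N : ℝ) + M + 1 := by positivity
  have hterm : ∀ x ∈ Ioi (0 : ℝ), ENNReal.ofReal (Real.exp x * polylogReal q x) *
      ∫⁻ t in Ioi x, ENNReal.ofReal
        (t ^ b / (b.factorial : ℝ) * Real.exp (-((N : ℝ) + M + 1) * t)) =
      ∑ p ∈ Finset.HasAntidiagonal.antidiagonal b,
        ENNReal.ofReal (1 / ((N : ℝ) + M + 1) ^ (p.1 + 1)) *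
        ENNReal.ofReal (x ^ p.2 / (p.2.factorial : ℝ) * Real.exp (-((N + M : ℕ) : ℝ) * x) *
          polylogReal q x) := fun x hx => by
    have hx' : 0 < x := hx
    have hφ := polylogReal_nonneg q x
    rw [lintegral_pow_mul_exp hc b hx'.le, incompleteGamma,
      ← ENNReal.ofReal_mul (by positivity), Finset.mul_sum,
      ENNReal.ofReal_sum_of_nonneg fun p _ => by positivity]
    refine Finset.sum_congr rfl fun p _ => ?_
    rw [← ENNReal.ofReal_mul (by positivity)]
    congr 1
    -- The factor `e^x` of the integral recursion lowers the rate from `N + M + 1` to `N + M`, which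
    -- keeps the inequalities between summation indices weak.
    have he : Real.exp (-((N + M : ℕ) : ℝ) * x) =
        Real.exp x * Real.exp (-((N : ℝ) + M + 1) * x) := by
      rw [← Real.exp_add]
      push_cast
      ring_nf
    rw [he]
    ring
  rw [setLIntegral_congr_fun measurableSet_Ioi hterm, lintegral_finsetSum' _ fun p _ => ?_]
  · refine Finset.sum_congr rfl fun p _ => ?_
    rw [lintegral_const_mul]
    · rfl
    · have := continuous_polylogReal q
      exact Measurable.ennreal_ofReal (Continuous.measurable (by fun_prop))
  · have := continuous_polylogReal q
    exact (Measurable.const_mul (Measurable.ennreal_ofReal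
      (Continuous.measurable (by fun_prop))) _).aemeasurable

theorem integrableOn_pow_mul_polylogReal (q b : ℕ) :
    IntegrableOn (fun t => t ^ b / (b.factorial : ℝ) * polylogReal q t) (Ioi 0) := by
  have h := (integrableOn_pow_mul_exp (c := 1 / 2) (by norm_num) b le_rfl).const_mul (2 ^ q : ℝ)
  have hcont := continuous_polylogReal q
  refine Integrable.mono' h (Continuous.aestronglyMeasurable (by fun_prop)) ?_
  filter_upwards [ae_restrict_mem measurableSet_Ioi] with t ht
  have ht' : 0 < t := ht
  have hφ := polylogReal_nonneg q t
  rw [Real.norm_of_nonneg (by positivity)]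
  calc t ^ b / (b.factorial : ℝ) * polylogReal q t
      ≤ t ^ b / (b.factorial : ℝ) * (2 ^ q * Real.exp (-(t / 2))) := by
        gcongr
        exact polylogReal_le q ht'
    _ = 2 ^ q * (t ^ b / (b.factorial : ℝ) * Real.exp (-(1 / 2) * t)) := by
        ring_nf

theorem polylogMoment_zero_eq_ofReal_integral (q b : ℕ) :
    polylogMoment q 0 b =
      ENNReal.ofReal (∫ t in Ioi (0 : ℝ), t ^ b / (b.factorial : ℝ) * polylogReal q t) := by
  rw [ofReal_integral_eq_lintegral_ofReal (integrableOn_pow_mul_polylogReal q b)]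
  · simp [polylogMoment]
  · filter_upwards [ae_restrict_mem measurableSet_Ioi] with t ht
    have ht' : 0 < t := ht
    have hφ := polylogReal_nonneg q t
    positivity

/-! ### Identification with multiple zeta star sums -/

theorem sum_antidiagonalTuple_succ {R : Type*} [AddCommMonoid R] (r b : ℕ)
    (f : (Fin (r + 1) → ℕ) → R) :
    ∑ a ∈ Finset.Nat.antidiagonalTuple (r + 1) b, f a =
      ∑ p ∈ Finset.HasAntidiagonal.antidiagonal b, ∑ a ∈ Finset.Nat.antidiagonalTuple r p.2,
        f (Fin.cons p.1 a) := by
  rw [Finset.sum_sigma']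
  symm
  refine Finset.sum_bij' (fun x _ => Fin.cons x.1.1 x.2)
    (fun a _ => ⟨(a 0, ∑ i, Fin.tail a i), Fin.tail a⟩) ?_ ?_ ?_ ?_ ?_
  · rintro ⟨⟨i, j⟩, a⟩ h
    simp only [Finset.mem_sigma, Finset.HasAntidiagonal.mem_antidiagonal,
      Finset.Nat.mem_antidiagonalTuple] at h ⊢
    rw [Fin.sum_cons, h.2, h.1]
  · intro a h
    rw [Finset.Nat.mem_antidiagonalTuple, Fin.sum_univ_succ] at h
    simp only [Finset.mem_sigma, Finset.HasAntidiagonal.mem_antidiagonal,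
      Finset.Nat.mem_antidiagonalTuple, and_true]
    exact h
  · rintro ⟨⟨i, j⟩, a⟩ h
    simp only [Finset.mem_sigma, Finset.HasAntidiagonal.mem_antidiagonal,
      Finset.Nat.mem_antidiagonalTuple] at h
    simp [h.2]
  · intro a _
    simp
  · intro x _
    rfl

/-- The exponents `(a₁ + 1, …, a_{r} + 1, a_{r+1} + 2)`. -/
def starExponent {r : ℕ} (a : Fin (r + 1) → ℕ) (i : Fin (r + 1)) : ℕ :=
  if i = Fin.last r then a i + 2 else a i + 1

theorem starExponent_cons {r : ℕ} (c : ℕ) (a : Fin (r + 1) → ℕ) :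
    starExponent (Fin.cons c a : Fin (r + 2) → ℕ) = Fin.cons (c + 1) (starExponent a) := by
  funext i
  refine Fin.cases ?_ (fun i => ?_) i
  · have : (0 : Fin (r + 2)) ≠ Fin.last (r + 1) := (Fin.last_pos).ne
    simp [starExponent, this]
  · simp [starExponent, ← Fin.succ_last]

open Classical in
/-- The multiple zeta star value with summation over `N < m₁ ≤ ⋯ ≤ m_r`. -/
noncomputable def zetaStarTail {r : ℕ} (N : ℕ) (p : Fin r → ℕ) : ENNReal :=
  ∑' m : Fin r → ℕ, if (∀ i, N ≤ m i) ∧ Monotone m then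
    ENNReal.ofReal (1 / ∏ i, ((m i : ℝ) + 1) ^ p i) else 0

theorem tsum_ite_le (N : ℕ) (f : ℕ → ENNReal) :
    ∑' M, f (N + M) = ∑' M, if N ≤ M then f M else 0 := by
  rw [← (add_right_injective N).tsum_eq (f := fun M => if N ≤ M then f M else 0)]
  · simp
  · intro M hM
    rw [Function.mem_support] at hM
    have : N ≤ M := by
      by_contra h
      simp [h] at hM
    exact ⟨M - N, by simp [this]⟩

theorem forall_le_and_monotone_cons {r : ℕ} (N M : ℕ) (m : Fin (r + 1) → ℕ) :
    ((∀ i, N ≤ (Fin.cons M m : Fin (r + 2) → ℕ) i) ∧ Monotone (Fin.cons M m : Fin (r + 2) → ℕ)) ↔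
      N ≤ M ∧ (∀ i, M ≤ m i) ∧ Monotone m := by
  have h : Monotone (Fin.cons M m : Fin (r + 2) → ℕ) ↔ M ≤ m 0 ∧ Monotone m :=
    monotone_vecCons
  rw [h, Fin.forall_fin_succ]
  simp only [Fin.cons_zero, Fin.cons_succ]
  constructor
  · rintro ⟨⟨h1, -⟩, h2, h3⟩
    exact ⟨h1, fun i => h2.trans (h3 (Fin.zero_le i)), h3⟩
  · rintro ⟨h1, h2, h3⟩
    exact ⟨⟨h1, fun i => h1.trans (h2 i)⟩, h2 0, h3⟩

/-- The smallest index is split off and becomes the lower bound for the others, matching the shape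
of `polylogMoment_succ`. -/
theorem zetaStarTail_cons {r : ℕ} (N c : ℕ) (p : Fin (r + 1) → ℕ) :
    zetaStarTail N (Fin.cons c p : Fin (r + 2) → ℕ) =
      ∑' M : ℕ, ENNReal.ofReal (1 / ((N : ℝ) + M + 1) ^ c) * zetaStarTail (N + M) p := by
  have h := tsum_ite_le N fun M => ENNReal.ofReal (1 / ((M : ℝ) + 1) ^ c) * zetaStarTail M p
  push_cast at h
  rw [h, zetaStarTail, ← (Fin.consEquiv fun _ : Fin (r + 2) => ℕ).tsum_eq, ENNReal.tsum_prod']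
  refine tsum_congr fun M => ?_
  by_cases hM : N ≤ M
  · rw [if_pos hM, zetaStarTail, ← ENNReal.tsum_mul_left]
    refine tsum_congr fun m => ?_
    change (if (∀ i, N ≤ (Fin.cons M m : Fin (r + 2) → ℕ) i) ∧
      Monotone (Fin.cons M m : Fin (r + 2) → ℕ) then _ else _) = _
    by_cases hm : (∀ i, M ≤ m i) ∧ Monotone m
    · rw [if_pos ((forall_le_and_monotone_cons N M m).2 ⟨hM, hm⟩), if_pos hm,
        ← ENNReal.ofReal_mul (by positivity), Fin.prod_univ_succ]
      simp [Fin.consEquiv, mul_comm]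
    · rw [if_neg fun h => hm ((forall_le_and_monotone_cons N M m).1 h).2, if_neg hm, mul_zero]
  · rw [if_neg hM, ENNReal.tsum_eq_zero]
    intro m
    exact if_neg fun h => hM ((forall_le_and_monotone_cons N M m).1 h).1

theorem zetaStarTail_one (N c : ℕ) :
    zetaStarTail N (fun _ : Fin 1 => c) =
      ∑' M : ℕ, ENNReal.ofReal (1 / ((N : ℝ) + M + 1) ^ c) := by
  have h := tsum_ite_le N fun M => ENNReal.ofReal (1 / ((M : ℝ) + 1) ^ c)
  push_cast at h
  rw [h, zetaStarTail, ← (Equiv.funUnique (Fin 1) ℕ).symm.tsum_eq]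
  refine tsum_congr fun M => ?_
  simp [Equiv.funUnique, Subsingleton.monotone]

theorem polylogMoment_succ_eq_sum (r N b : ℕ) :
    polylogMoment (r + 1) N b = ∑ a ∈ Finset.Nat.antidiagonalTuple (r + 1) b,
      ENNReal.ofReal ((a (Fin.last r) : ℝ) + 1) * zetaStarTail N (starExponent a) := by
  induction r generalizing N b with
  | zero =>
    rw [polylogMoment_succ, Finset.Nat.antidiagonalTuple_one, Finset.sum_singleton]
    have e : starExponent ![b] = fun _ : Fin 1 => b + 2 := by
      funext i
      obtain rfl : i = Fin.last 0 := Fin.fin_one_eq_zero i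
      simp [starExponent]
    rw [e, zetaStarTail_one, ← ENNReal.tsum_mul_left]
    refine tsum_congr fun M => ?_
    have hc : ((N : ℝ) + M + 1) ≠ 0 := by positivity
    -- At the innermost level all `b + 1` pairs give the same term with exponent `(p.1 + 1) + (p.2 +
    -- 1) = b + 2`: hence the weight `a_j + 1` and the last exponent `a_j + 2`.
    have hterm : ∀ p ∈ Finset.HasAntidiagonal.antidiagonal b,
        ENNReal.ofReal (1 / ((N : ℝ) + M + 1) ^ (p.1 + 1)) * polylogMoment 0 (N + M) p.2 =
        ENNReal.ofReal (1 / ((N : ℝ) + M + 1) ^ (b + 2)) := fun p hp => by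
      rw [Finset.HasAntidiagonal.mem_antidiagonal] at hp
      rw [polylogMoment_zero, ← ENNReal.ofReal_mul (by positivity), ← hp]
      congr 1
      push_cast
      rw [div_mul_div_comm, ← pow_add, one_mul]
      congr 2
      ring
    rw [Finset.sum_congr rfl hterm, Finset.sum_const, Finset.Nat.card_antidiagonal, nsmul_eq_mul]
    congr 1
    simp only [Matrix.cons_val_fin_one]
    rw [← ENNReal.ofReal_natCast]
    push_cast
    rfl
  | succ r ih =>
    rw [polylogMoment_succ, sum_antidiagonalTuple_succ,
      Summable.tsum_finsetSum fun _ _ => ENNReal.summable]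
    refine Finset.sum_congr rfl fun p _ => ?_
    simp_rw [ih, Finset.mul_sum]
    rw [Summable.tsum_finsetSum fun _ _ => ENNReal.summable]
    refine Finset.sum_congr rfl fun a _ => ?_
    rw [starExponent_cons, zetaStarTail_cons, ← ENNReal.tsum_mul_left]
    refine tsum_congr fun M => ?_
    rw [← Fin.succ_last, Fin.cons_succ, mul_left_comm]

/-- The indices are shifted by one. No convergence is required, since a divergent series gives `0`
on both sides. -/
theorem toReal_zetaStarTail_zero {r : ℕ} (p : Fin r → ℕ) :
    (zetaStarTail 0 p).toReal = zetaStar p := by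
  classical
  have hinj : Function.Injective fun (m : Fin r → ℕ) i => m i + 1 := fun m m' h => by
    funext i
    exact Nat.succ_injective (congrFun h i)
  set s : Set (Fin r → ℕ) := {m | (∀ i, 0 < m i) ∧ Monotone m} with hs
  set F : (Fin r → ℕ) → ENNReal := fun m => ENNReal.ofReal (1 / ∏ i, ((m i : ℝ) ^ p i)) with hF
  have h1 : zetaStarTail 0 p = ∑' m, s.indicator F m := by
    rw [← hinj.tsum_eq (f := s.indicator F)]
    · refine tsum_congr fun m => ?_
      have : ((fun i => m i + 1) ∈ s) ↔ (∀ i, 0 ≤ m i) ∧ Monotone m := by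
        simp [hs, Monotone]
      rw [indicator_apply]
      simp only [this, hF]
      push_cast
      rfl
    · intro m hm
      have hm' : m ∈ s := mem_of_indicator_ne_zero hm
      refine ⟨fun i => m i - 1, funext fun i => ?_⟩
      exact Nat.sub_add_cancel (hm'.1 i)
  rw [h1, ← tsum_subtype, ENNReal.tsum_toReal_eq fun _ => ENNReal.ofReal_ne_top, zetaStar]
  refine tsum_congr fun m => ENNReal.toReal_ofReal (by positivity)

theorem integral_pow_mul_polylogReal (m q : ℕ) :
    ∫ t in Ioi (0 : ℝ), t ^ m / (m.factorial : ℝ) * polylogReal q t = zetaStarSum m q := by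
  have hnonneg : 0 ≤ ∫ t in Ioi (0 : ℝ), t ^ m / (m.factorial : ℝ) * polylogReal q t := by
    refine setIntegral_nonneg measurableSet_Ioi fun t ht => ?_
    have ht' : 0 < t := ht
    have := polylogReal_nonneg q t
    positivity
  rw [← ENNReal.toReal_ofReal hnonneg, ← polylogMoment_zero_eq_ofReal_integral]
  cases q with
  | zero => simp [polylogMoment_zero, zetaStarSum]
  | succ r =>
    -- Finiteness of the integral forces finiteness of every zeta star term, so `toReal` may be
    -- distributed over the sum.
    have htop : polylogMoment (r + 1) 0 m ≠ ⊤ := by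
      rw [polylogMoment_zero_eq_ofReal_integral]
      exact ENNReal.ofReal_ne_top
    rw [polylogMoment_succ_eq_sum] at htop ⊢
    rw [ENNReal.toReal_sum fun a ha => ((Finset.single_le_sum (fun _ _ => zero_le)
      ha).trans_lt htop.lt_top).ne, zetaStarSum]
    refine Finset.sum_congr rfl fun a _ => ?_
    rw [ENNReal.toReal_mul, ENNReal.toReal_ofReal (by positivity), toReal_zetaStarTail_zero]
    rfl

/-! ### Poly-Bernoulli numbers as moments -/

theorem derivative_oneSubExpNeg :
    PowerSeries.derivative ℚ oneSubExpNeg = 1 - oneSubExpNeg := by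
  ext n
  rw [PowerSeries.coeff_derivative, oneSubExpNeg, sub_sub_cancel, map_sub,
    PowerSeries.coeff_rescale, PowerSeries.coeff_rescale, PowerSeries.coeff_exp,
    PowerSeries.coeff_exp, PowerSeries.coeff_one, if_neg n.succ_ne_zero, Nat.factorial_succ]
  have : (n.factorial : ℚ) ≠ 0 := by exact_mod_cast n.factorial_ne_zero
  simp only [eq_ratCast, Rat.cast_eq_id, id]
  push_cast
  field_simp
  ring

/-- With `w = 1 - e^{-t}` one has `w' = 1 - w`, so `(w^{j+1})' = (j + 1)(w^j - w^{j+1})`; comparing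
coefficients gives the recursion of `polyBernoulliCoeff`. -/
theorem factorial_mul_coeff_oneSubExpNeg_pow (p j : ℕ) :
    (p.factorial : ℚ) * PowerSeries.coeff p (oneSubExpNeg ^ j) = polyBernoulliCoeff p j := by
  induction p generalizing j with
  | zero =>
    cases j with
    | zero => simp [polyBernoulliCoeff]
    | succ j =>
      have : PowerSeries.constantCoeff oneSubExpNeg = 0 := by
        rw [oneSubExpNeg, map_sub, ← PowerSeries.coeff_zero_eq_constantCoeff_apply
          (PowerSeries.rescale (-1 : ℚ) (PowerSeries.exp ℚ)), PowerSeries.coeff_rescale]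
        simp
      simp [polyBernoulliCoeff, this]
  | succ p ih =>
    cases j with
    | zero => simp [polyBernoulliCoeff, PowerSeries.coeff_one]
    | succ j =>
      have h := congrArg (PowerSeries.coeff p)
        (PowerSeries.derivative_pow oneSubExpNeg (j + 1))
      rw [PowerSeries.coeff_derivative, derivative_oneSubExpNeg, Nat.add_sub_cancel,
        mul_assoc, mul_sub, mul_one, ← pow_succ, ← nsmul_eq_mul, map_nsmul, map_sub,
        nsmul_eq_mul] at h
      rw [polyBernoulliCoeff]
      push_cast at h ⊢
      rw [← ih, ← ih, Nat.factorial_succ]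
      push_cast
      linear_combination (p.factorial : ℚ) * h

theorem polyBernoulli_eq_sum (k : ℤ) (p : ℕ) :
    polyBernoulli k p =
      ∑ j ∈ Finset.range (p + 1), (polyBernoulliCoeff p j : ℚ) / ((j : ℚ) + 1) ^ k := by
  rw [polyBernoulli, polyBernoulliSeries, PowerSeries.coeff_subst' hasSubst_oneSubExpNeg,
    finsum_eq_sum_of_support_subset (s := Finset.range (p + 1)), Finset.mul_sum]
  · refine Finset.sum_congr rfl fun j _ => ?_
    rw [← factorial_mul_coeff_oneSubExpNeg_pow, polylogSeriesDivX, PowerSeries.coeff_mk,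
      smul_eq_mul]
    ring
  · intro j hj
    rw [Finset.coe_range, mem_Iio, Nat.lt_succ_iff]
    by_contra h
    apply hj
    have h1 := factorial_mul_coeff_oneSubExpNeg_pow p j
    rw [polyBernoulliCoeff_eq_zero (not_le.1 h), Int.cast_zero] at h1
    have h2 : (p.factorial : ℚ) ≠ 0 := by exact_mod_cast p.factorial_ne_zero
    simp only [(mul_eq_zero.1 h1).resolve_left h2, smul_zero]

theorem polylogDivNeg_one_sub_exp (p : ℕ) (t : ℝ) :
    polylogDivNeg p (1 - Complex.exp t) =
      ∑ j ∈ Finset.range (p + 1),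
        (polyBernoulliCoeff p j : ℂ) * (Real.exp (-((j : ℝ) + 1) * t) : ℝ) := by
  refine Finset.sum_congr rfl fun j _ => ?_
  rw [sub_sub_cancel, ← Complex.exp_nat_mul, one_div, ← Complex.exp_neg]
  push_cast
  ring_nf

/-- The exponential `e^{-(j+1)t}` has moment `1 / (j + 1)^{m+1}`, so the integral is the finite sum
of `polyBernoulli_eq_sum`. -/
theorem hasIntegral_pow_mul_polylogDivNeg (m p : ℕ) :
    IntegrableOn (fun t : ℝ => ((t ^ m / (m.factorial : ℝ) : ℝ) : ℂ) *
      polylogDivNeg p (1 - Complex.exp t)) (Ioi 0) ∧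
    ∫ t in Ioi (0 : ℝ), ((t ^ m / (m.factorial : ℝ) : ℝ) : ℂ) *
      polylogDivNeg p (1 - Complex.exp t) = (polyBernoulli ((m : ℤ) + 1) p : ℂ) := by
  have e : (fun t : ℝ => ((t ^ m / (m.factorial : ℝ) : ℝ) : ℂ) *
      polylogDivNeg p (1 - Complex.exp t)) = fun t : ℝ => ∑ j ∈ Finset.range (p + 1),
        (polyBernoulliCoeff p j : ℂ) *
          ((t ^ m / (m.factorial : ℝ) * Real.exp (-((j : ℝ) + 1) * t) : ℝ) : ℂ) := by
    funext t
    rw [polylogDivNeg_one_sub_exp, Finset.mul_sum]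
    refine Finset.sum_congr rfl fun j _ => ?_
    push_cast
    ring
  have hi : ∀ j ∈ Finset.range (p + 1), IntegrableOn (fun t : ℝ => (polyBernoulliCoeff p j : ℂ) *
      ((t ^ m / (m.factorial : ℝ) * Real.exp (-((j : ℝ) + 1) * t) : ℝ) : ℂ)) (Ioi 0) :=
    fun j _ => (Integrable.ofReal
      (integrableOn_pow_mul_exp (c := (j : ℝ) + 1) (by positivity) m le_rfl)).const_mul _
  rw [e]
  refine ⟨integrable_finsetSum _ hi, ?_⟩
  rw [integral_finsetSum _ hi, polyBernoulli_eq_sum, Rat.cast_sum]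
  refine Finset.sum_congr rfl fun j _ => ?_
  have h := integral_pow_mul_exp (c := (j : ℝ) + 1) (by positivity) m le_rfl
  rw [incompleteGamma_zero_right] at h
  rw [integral_const_mul, integral_complex_ofReal, h]
  push_cast
  rw [mul_one_div]
  norm_cast

theorem hasIntegral_pow_mul_polylogDiv (m q : ℕ) :
    IntegrableOn (fun t : ℝ => ((t ^ m / (m.factorial : ℝ) : ℝ) : ℂ) *
      polylogDiv q (1 - Complex.exp t)) (Ioi 0) ∧
    ∫ t in Ioi (0 : ℝ), ((t ^ m / (m.factorial : ℝ) : ℝ) : ℂ) *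
      polylogDiv q (1 - Complex.exp t) = (zetaStarSum m q : ℂ) := by
  simp_rw [polylogDiv_one_sub_exp, ← Complex.ofReal_mul]
  refine ⟨Integrable.ofReal (integrableOn_pow_mul_polylogReal q m), ?_⟩
  rw [integral_complex_ofReal, integral_pow_mul_polylogReal]

theorem integrableOn_pow_mul_polylogDivInt (m : ℕ) (q : ℤ) :
    IntegrableOn (fun t : ℝ => ((t ^ m / (m.factorial : ℝ) : ℝ) : ℂ) *
      polylogDivInt q (1 - Complex.exp t)) (Ioi 0) := by
  cases q with
  | ofNat q => exact (hasIntegral_pow_mul_polylogDiv m q).1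
  | negSucc p => exact (hasIntegral_pow_mul_polylogDivNeg m (p + 1)).1

/-! ### Assembly of the eta values -/

theorem etaIntegrand_eq (m n k : ℕ) {t : ℝ} (ht : 0 < t) :
    etaIntegrand (-(n : ℤ)) k ((m : ℂ) + 1) t =
      ∑ l ∈ Finset.Icc 0 (n + 1), (m.factorial : ℂ) * faulhaberD n l *
        (((t ^ m / (m.factorial : ℝ) : ℝ) : ℂ) *
          polylogDivInt ((k : ℤ) - l) (1 - Complex.exp t)) := by
  have hz : 1 - Complex.exp (t : ℂ) ≠ 0 := by
    rw [← Complex.ofReal_exp, ← Complex.ofReal_one, ← Complex.ofReal_sub, Complex.ofReal_ne_zero]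
    linarith [Real.add_one_le_exp t]
  have hm : (m.factorial : ℂ) ≠ 0 := by exact_mod_cast m.factorial_ne_zero
  -- Dividing by `1 - e^t`, nonzero for `t > 0`, cancels the factor `z` in `doublePolylogSum`; the
  -- inserted `m!` will cancel `Γ(m + 1)`.
  rw [etaIntegrand, (isDoublePolylog_doublePolylog n k).eqOn
    (isDoublePolylog_doublePolylogSum n k) (one_sub_exp_mem_cutPlane t), doublePolylogSum,
    add_sub_cancel_right, Complex.cpow_natCast, Finset.sum_div, Finset.mul_sum]
  refine Finset.sum_congr rfl fun l _ => ?_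
  push_cast
  field_simp

theorem integrableOn_etaIntegrand (m n k : ℕ) :
    IntegrableOn (etaIntegrand (-(n : ℤ)) k ((m : ℂ) + 1)) (Ioi 0) := by
  refine (integrableOn_congr_fun (fun t ht => etaIntegrand_eq m n k ht) measurableSet_Ioi).2 ?_
  exact integrable_finsetSum _ fun l _ => (integrableOn_pow_mul_polylogDivInt m _).const_mul _

theorem etaFun_eq_sum (m n k : ℕ) :
    etaFun (-(n : ℤ)) k ((m : ℂ) + 1) = ∑ l ∈ Finset.Icc 0 (n + 1), faulhaberD n l *
      ∫ t in Ioi (0 : ℝ), ((t ^ m / (m.factorial : ℝ) : ℝ) : ℂ) *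
        polylogDivInt ((k : ℤ) - l) (1 - Complex.exp t) := by
  have hm : (m.factorial : ℂ) ≠ 0 := by exact_mod_cast m.factorial_ne_zero
  rw [etaFun, setIntegral_congr_fun measurableSet_Ioi fun t ht => etaIntegrand_eq m n k ht,
    integral_finsetSum _ fun l _ => (integrableOn_pow_mul_polylogDivInt m _).const_mul _,
    Complex.Gamma_nat_eq_factorial, Finset.mul_sum]
  refine Finset.sum_congr rfl fun l _ => ?_
  rw [integral_const_mul]
  field_simp

theorem integral_polylogDivInt_of_le (m : ℕ) {k l : ℕ} (h : l ≤ k) :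
    ∫ t in Ioi (0 : ℝ), ((t ^ m / (m.factorial : ℝ) : ℝ) : ℂ) *
      polylogDivInt ((k : ℤ) - l) (1 - Complex.exp t) = (zetaStarSum m (k - l) : ℂ) := by
  rw [← Nat.cast_sub h, polylogDivInt_natCast, (hasIntegral_pow_mul_polylogDiv m (k - l)).2]

theorem integral_polylogDivInt_of_ge (m : ℕ) {k l : ℕ} (h : k ≤ l) :
    ∫ t in Ioi (0 : ℝ), ((t ^ m / (m.factorial : ℝ) : ℝ) : ℂ) *
      polylogDivInt ((k : ℤ) - l) (1 - Complex.exp t) =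
        (polyBernoulli ((m : ℤ) + 1) (l - k) : ℂ) := by
  rw [← neg_sub, ← Nat.cast_sub h, polylogDivInt_neg_natCast,
    (hasIntegral_pow_mul_polylogDivNeg m (l - k)).2]

theorem mainTheorem2 (m k n : ℕ) (hk : 1 ≤ k) :
    -- the continuation of the double polylogarithm exists and the integral converges absolutely
    IsDoublePolylog (-(n : ℤ)) (k : ℤ) (doublePolylog (-(n : ℤ)) (k : ℤ)) ∧
    MeasureTheory.IntegrableOn (etaIntegrand (-(n : ℤ)) (k : ℤ) ((m : ℂ) + 1)) (Set.Ioi (0 : ℝ)) ∧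
    (n < k →
      etaFun (-(n : ℤ)) (k : ℤ) ((m : ℂ) + 1) =
        ∑ l ∈ Finset.Icc 0 (n + 1), faulhaberD n l * (zetaStarSum m (k - l) : ℂ)) ∧
    (k ≤ n →
      etaFun (-(n : ℤ)) (k : ℤ) ((m : ℂ) + 1) =
        ∑ l ∈ Finset.Icc 0 (k - 1), faulhaberD n l * (zetaStarSum m (k - l) : ℂ) +
        ∑ l ∈ Finset.Icc k (n + 1),
          faulhaberD n l * (polyBernoulli ((m : ℤ) + 1) (l - k) : ℂ)) := by
  refine ⟨isDoublePolylog_doublePolylog n k, integrableOn_etaIntegrand m n k, fun h => ?_,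
    fun h => ?_⟩
  -- Here `l ≤ n + 1 ≤ k`, so every order `k - l` is nonnegative and no poly-Bernoulli term occurs.
  · rw [etaFun_eq_sum]
    refine Finset.sum_congr rfl fun l hl => ?_
    rw [Finset.mem_Icc] at hl
    rw [integral_polylogDivInt_of_le m (by omega)]
  · have hunion : Finset.Icc 0 (n + 1) = Finset.Icc 0 (k - 1) ∪ Finset.Icc k (n + 1) := by
      ext l
      simp only [Finset.mem_union, Finset.mem_Icc]
      omega
    have hdisj : Disjoint (Finset.Icc 0 (k - 1)) (Finset.Icc k (n + 1)) := by
      rw [Finset.disjoint_left]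
      intro l h1 h2
      rw [Finset.mem_Icc] at h1 h2
      omega
    rw [etaFun_eq_sum, hunion, Finset.sum_union hdisj]
    congr 1
    · refine Finset.sum_congr rfl fun l hl => ?_
      rw [Finset.mem_Icc] at hl
      rw [integral_polylogDivInt_of_le m (by omega)]
    · refine Finset.sum_congr rfl fun l hl => ?_
      rw [Finset.mem_Icc] at hl
      rw [integral_polylogDivInt_of_ge m hl.1]
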